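/- Let $(K,v)$ be a henselian valued field of rank one (i.e. $vK$ has exactly one proper convex subgroup, namely $\{0\}$), let $\overline K$ be an algebraic closure of $K$, and denote the unique extension of $v$ to $\overline K$ again by $v$. Write $\deg_K(z)=[K(z):K]$ for $z\in\overline K$. *Depth.* For $a\in\overline K\setminus K$ and $d<\deg_K(a)$ put $D_d=\{v(z-a)\mid z\in\overline K,\ \deg_K(z)=d\}$. An Okutsu sequence of length $n$ of $a$ over $K$ is a sequence $A_0=\{a\},A_1,\dots,A_n$ of non-empty subsets of $\overline K$, all elements of $A_i$ having the same degree $d_i$ over $K$, such that $\deg_K(a)=d_0>d_1>\dots>d_n=1$ and for all $1\le i\le n$: 1. for every $z\in\overline K$ with $\deg_K(z)<d_{i-1}$ there is $y\in A_i$ with $v(a-y)\ge v(a-z)$; 2. $v(a-x)>v(a-y)$ for all $x\in A_{i-1}$, $y\in A_i$; 3. $\#A_i=1$ if and only if $\max D_{d_i}$ exists, and in this case $A_i=\{a_i\}$ with $v(a-a_i)=\max D_{d_i}=\max\{v(a-z)\mid \deg_K(z)<d_{i-1}\}$; 4. if $\max D_{d_i}$ does not exist, then $A_i=\{z_\nu\}_{\nu<\lambda}$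 for a limit ordinal $\lambda$, with $v(a-z_\mu)>v(a-z_\nu)$ whenever $\nu<\mu<\lambda$. Okutsu sequences of $a$ exist and all have the same length, which is called the depth of $a$ over $K$; $a$ is pure over $K$ if its depth is $1$. The depth of a finite simple extension $\Omega|K$ with $\Omega\ne K$ is the minimum of the depths of its generators. *Ramification ideals.* Let $\mathcal E=(\Omega|K,v)$ be a finite Galois extension with $\Omega\subseteq\overline K$, and let $\mathcal O_\Omega$ be the valuation ring of $(\Omega,v)$, with maximal ideal $\mathcal M_\Omega$. For a subgroup $H$ of $\mathrm{Gal}(\Omega|K)$ let $\mathcal I_H$ be the ideal of $\mathcal O_\Omega$ generated by all $\frac{\sigma z}{z}-1$ with $\sigma\in H$ and $z\in\Omega^\times$. Let $\mathrm{Ram}(\mathcal E)$ be the set of all ideals $\mathcal I$ of $\mathcal O_\Omega$ such that $(0)\subsetneq\mathcal I\subseteq\mathcal M_\Omega$ and $\mathcal I=\mathcal I_H$ for some subgroup $H$. **Theorem.** Assume that $\mathcal E=(\Omega|K,v)$ is a finite Galois extension which has defect, i.e. $\frac{[\Omega:K]}{(v\Omega:vK)\,[\Omega v:Kv]}>1$,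 and that the depth of $\Omega|K$ is $1$. Then for every generator $a$ of $\Omega|K$ (i.e. $\Omega=K(a)$) which is pure over $K$, $$\#\mathrm{Ram}(\mathcal E)=\#S_K(a),\qquad\text{where } S_K(a)=\{v(a-a')\mid a'\ne a \text{ is a } K\text{-conjugate of } a\}.$$ -/

import Mathlib

open scoped IntermediateField

universe u

noncomputable section

/-! Valued fields are written additively: `AddValuation F (WithTop Γ)` with `v x = ⊤` only for
`x = 0`, and `Γ` a linearly ordered abelian group which may be larger than the value group. -/

namespace RamIdeals

section Valuations

variable {F Γ : Type*} [Field F] [AddCommGroup Γ] [LinearOrder Γ] [IsOrderedAddMonoid Γ]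

/-- The valuation ring `{x | 0 ≤ v x}` of `(F, v)`. -/
def valRing (v : AddValuation F (WithTop Γ)) : ValuationSubring F where
  carrier := {x | 0 ≤ v x}
  mul_mem' {x y} hx hy := by
    change 0 ≤ v (x * y)
    rw [AddValuation.map_mul]
    exact add_nonneg hx hy
  one_mem' := by simp
  add_mem' {x y} hx hy := (le_min hx hy).trans (v.map_add x y)
  zero_mem' := by simp
  neg_mem' {x} hx := by simpa [AddValuation.map_neg] using hx
  mem_or_inv_mem' x := by
    by_cases h0 : x = 0
    · left; simp [h0]
    rcases le_total 0 (v x) with h | h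
    · exact Or.inl h
    · right
      have h1 : v x + v x⁻¹ = 0 := by
        rw [← AddValuation.map_mul, mul_inv_cancel₀ h0, AddValuation.map_one]
      change 0 ≤ v x⁻¹
      rw [← h1]
      simpa using add_le_add_left h (v x⁻¹)

/-- The value group `vF = {v x | x ≠ 0}` of `(F, v)`, as a subgroup of `Γ`. -/
def valueGroup (v : AddValuation F (WithTop Γ)) : AddSubgroup Γ where
  carrier := {γ | ∃ x : F, v x = (γ : WithTop Γ)}
  add_mem' := by
    rintro _ _ ⟨x, hx⟩ ⟨y, hy⟩
    exact ⟨x * y, by rw [AddValuation.map_mul, hx, hy, WithTop.coe_add]⟩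
  zero_mem' := ⟨1, by simp⟩
  neg_mem' := by
    rintro γ ⟨x, hx⟩
    refine ⟨x⁻¹, ?_⟩
    have h0 : x ≠ 0 := by
      rintro rfl
      simp at hx
    have h1 : v x + v x⁻¹ = 0 := by
      rw [← AddValuation.map_mul, mul_inv_cancel₀ h0, AddValuation.map_one]
    have h2 : v x⁻¹ ≠ ⊤ := fun h => by simp [h] at h1
    lift v x⁻¹ to Γ using h2 with δ hδ
    rw [hx, ← WithTop.coe_add, ← WithTop.coe_zero, WithTop.coe_inj] at h1
    rw [WithTop.coe_inj]
    exact eq_neg_of_add_eq_zero_right h1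

/-- The rank of `(F, v)`: the number of proper convex subgroups of its value group. -/
def rank (v : AddValuation F (WithTop Γ)) : ℕ∞ :=
  Set.encard {H : AddSubgroup (valueGroup v) | H ≠ ⊤ ∧ (H : Set (valueGroup v)).OrdConnected}

/-- `(F, v)` is henselian: `v` has a unique extension (i.e. its valuation ring has a unique
valuation ring above it) to an algebraic closure of `F`. -/
def IsHenselian (v : AddValuation F (WithTop Γ)) : Prop :=
  ∃! B : ValuationSubring (AlgebraicClosure F),
    B.comap (algebraMap F (AlgebraicClosure F)) = valRing v

end Valuations

section Extensions

variable {C Γ : Type*} [Field C] [AddCommGroup Γ] [LinearOrder Γ] [IsOrderedAddMonoid Γ]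

/-- The restriction of `v` to a field `F` which is embedded in `C`. -/
abbrev restr (v : AddValuation C (WithTop Γ)) (F : Type*) [Field F] [Algebra F C] :
    AddValuation F (WithTop Γ) :=
  v.comap (algebraMap F C)

/-- The residue field `Fv` of a field `F` embedded in `C`, as a subfield of `Cv`. -/
def residueSubfield (v : AddValuation C (WithTop Γ)) (F : Type*) [Field F] [Algebra F C] :
    Subfield (IsLocalRing.ResidueField (valRing v)) where
  carrier := {ξ | ∃ (x : F) (h : algebraMap F C x ∈ valRing v),
    IsLocalRing.residue (valRing v) ⟨algebraMap F C x, h⟩ = ξ}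
  mul_mem' := by
    rintro _ _ ⟨x, hx, rfl⟩ ⟨y, hy, rfl⟩
    refine ⟨x * y, by rw [map_mul]; exact mul_mem hx hy, ?_⟩
    rw [← map_mul (IsLocalRing.residue (valRing v))]
    congr 1
    ext
    simp
  one_mem' := ⟨1, by rw [map_one]; exact one_mem _, by
    rw [← map_one (IsLocalRing.residue (valRing v))]
    congr 1
    ext
    simp⟩
  add_mem' := by
    rintro _ _ ⟨x, hx, rfl⟩ ⟨y, hy, rfl⟩
    refine ⟨x + y, by rw [map_add]; exact add_mem hx hy, ?_⟩
    rw [← map_add (IsLocalRing.residue (valRing v))]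
    congr 1
    ext
    simp
  zero_mem' := ⟨0, by rw [map_zero]; exact zero_mem _, by
    rw [← map_zero (IsLocalRing.residue (valRing v))]
    congr 1
    ext
    simp⟩
  neg_mem' := by
    rintro _ ⟨x, hx, rfl⟩
    refine ⟨-x, by rw [map_neg]; exact neg_mem hx, ?_⟩
    rw [← map_neg (IsLocalRing.residue (valRing v))]
    congr 1
    ext
    simp
  inv_mem' := by
    rintro _ ⟨x, hx, rfl⟩
    by_cases h : IsLocalRing.residue (valRing v) ⟨algebraMap F C x, hx⟩ = 0
    · refine ⟨0, by rw [map_zero]; exact zero_mem _, ?_⟩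
      rw [h, inv_zero, ← map_zero (IsLocalRing.residue (valRing v))]
      congr 1
      ext
      simp
    · obtain ⟨u, hu⟩ := (IsLocalRing.residue_ne_zero_iff_isUnit _).1 h
      have h1 : algebraMap F C x * ((u⁻¹ : (valRing v)ˣ) : valRing v) = 1 := by
        have := congrArg Subtype.val (u.mul_inv)
        rw [hu] at this
        simpa using this
      have h2 : algebraMap F C x⁻¹ = ((u⁻¹ : (valRing v)ˣ) : valRing v) := by
        rw [map_inv₀]
        exact inv_eq_of_mul_eq_one_right h1
      refine ⟨x⁻¹, by rw [h2]; exact Subtype.property _, ?_⟩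
      apply eq_inv_of_mul_eq_one_right
      rw [← map_mul (IsLocalRing.residue (valRing v)),
        ← map_one (IsLocalRing.residue (valRing v))]
      congr 1
      ext
      change algebraMap F C x * algebraMap F C x⁻¹ = 1
      rw [h2, h1]

variable (K : Type*) [Field K] [Algebra K C]

/-- The defect `[E : K] / ((vE : vK) [Ev : Kv])` of a finite extension `(E|K, v)`. -/
def defect (v : AddValuation C (WithTop Γ)) (E : IntermediateField K C) : ℚ :=
  (Module.finrank K E : ℚ) /
    ((valueGroup (restr v K)).relIndex (valueGroup (restr v E)) *
      (residueSubfield v K).relfinrank (residueSubfield v E))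

/-- The degree of `z` over `K`. -/
def deg (z : C) : ℕ := (minpoly K z).natDegree

/-- `S_K(a) = {v (a - a') | a' ≠ a is a K-conjugate of a}`. -/
def conjDist (v : AddValuation C (WithTop Γ)) (a : C) : Set (WithTop Γ) :=
  {γ | ∃ a' : C, a' ≠ a ∧ IsConjRoot K a a' ∧ v (a - a') = γ}

/-- `D_d(a, K) = {v (z - a) | deg_K z = d}`. -/
def degDist (v : AddValuation C (WithTop Γ)) (a : C) (d : ℕ) : Set (WithTop Γ) :=
  {γ | ∃ z : C, deg K z = d ∧ v (z - a) = γ}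

/-- `A 0, …, A n` is an Okutsu sequence (of length `n`) of `a` over `K`, where `d i` is the common
degree over `K` of the elements of `A i`. (The values of `A` and `d` beyond `n` play no role.) -/
structure IsOkutsuSequence {C : Type u} {Γ : Type*} [Field C] [AddCommGroup Γ] [LinearOrder Γ]
    [IsOrderedAddMonoid Γ] (K : Type*) [Field K] [Algebra K C]
    (v : AddValuation C (WithTop Γ)) (a : C) (n : ℕ) (A : ℕ → Set C) (d : ℕ → ℕ) : Prop where
  first : A 0 = {a}
  nonempty : ∀ i ≤ n, (A i).Nonempty
  common_degree : ∀ i ≤ n, ∀ z ∈ A i, deg K z = d i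
  degree_lt : ∀ i < n, d (i + 1) < d i
  degree_last : d n = 1
  approx : ∀ i < n, ∀ z : C, deg K z < d i → ∃ y ∈ A (i + 1), v (a - z) ≤ v (a - y)
  closer : ∀ i < n, ∀ y ∈ A (i + 1), ∀ x ∈ A i, v (a - y) < v (a - x)
  singleton_iff : ∀ i < n,
    (∃ b, A (i + 1) = {b}) ↔ ∃ M, IsGreatest (degDist K v a (d (i + 1))) M
  singleton : ∀ i < n, ∀ b, A (i + 1) = {b} →
    IsGreatest (degDist K v a (d (i + 1))) (v (a - b)) ∧
    IsGreatest {γ | ∃ z : C, deg K z < d i ∧ v (a - z) = γ} (v (a - b))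
  limit : ∀ i < n, (¬ ∃ M, IsGreatest (degDist K v a (d (i + 1))) M) →
    ∃ (o : Ordinal.{u}) (z : Set.Iio o → C), Order.IsSuccLimit o ∧ Set.range z = A (i + 1) ∧
      StrictMono fun ν => v (a - z ν)

/-- The depth `ℓ_K(a)` of `a ∉ K`: the length of its Okutsu sequences (which always exist and all
have the same length). -/
def depth (v : AddValuation C (WithTop Γ)) (a : C) : ℕ :=
  sInf {n | ∃ A d, IsOkutsuSequence K v a n A d}

/-- `a` is pure over `K`: it has depth one. -/
def IsPure (v : AddValuation C (WithTop Γ)) (a : C) : Prop := depth K v a = 1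

/-- The depth of an extension `E|K`: the least depth of a generator. -/
def extDepth (v : AddValuation C (WithTop Γ)) (E : IntermediateField K C) : ℕ :=
  sInf {n | ∃ a : C, K⟮a⟯ = E ∧ depth K v a = n}

variable {K}

/-- The ideal `I_H = (σ z / z - 1 | σ ∈ H, z ∈ E^×)` of `O_E`. (All these elements lie in `O_E`
when `v` is invariant under `H`, as it is over a henselian `K`.) -/
def ramIdeal (v : AddValuation C (WithTop Γ)) (E : IntermediateField K C)
    (H : Subgroup (E ≃ₐ[K] E)) : Ideal (valRing (restr v E)) :=
  Ideal.span {x | ∃ σ ∈ H, ∃ z : E, z ≠ 0 ∧ (x : E) = σ z / z - 1}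

/-- The set `Ram(E|K, v)` of ramification ideals: those `I_H` with `0 ≠ I_H ⊆ M_E`. -/
def ramSet (v : AddValuation C (WithTop Γ)) (E : IntermediateField K C) :
    Set (Ideal (valRing (restr v E))) :=
  {I | ⊥ < I ∧ I ≤ IsLocalRing.maximalIdeal (valRing (restr v E)) ∧
    ∃ H : Subgroup (E ≃ₐ[K] E), I = ramIdeal v E H}

end Extensions

end RamIdeals

end

/-! Write `n` for the degree of `a`. Everything is governed by the values `v (a - y)`, `y ∈ K`.

Defect makes these distances have no maximum (`IsPure.exists_lt`). If nothing of degree less than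
`n` were closer to `a` than some `b ∈ K`, the powers `(a - b) ^ i`, `i < n`, would be
valuation-independent over `K`, so `n` would be at most ramification index times residue degree.
Hence something of smaller degree is closer, and purity replaces it by an element of `K`.

Purity also computes the ramification ideals. An element `z ≠ 0` of `Ω` is `f(a)` with `deg f < n`,
and some `y ∈ K` is at least as close to `a` as every root of `f`. Comparing `f(σ a)` with `f(a)`
factor by factor gives `v (σ z / z - 1) ≥ v (a - σ a) - v (a - y)`, with equality for `z = a - y`.
So `I_H` depends only on `s`, the minimum of `v (a - σ a)` over `H`, and equals `distIdeal` at `s`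
(`ramIdeal_eq_distIdeal`). Cyclic subgroups realise every `s` in `S_K(a)`.

Finally, `s` can be recovered from its ideal (`injOn_distIdeal`): if `s < s'` gave the same ideal,
the set of distances from `a` to `K` would be cofinally stable under adding `s' - s`. In rank one it
would then be unbounded, but `s` bounds it. -/

noncomputable section

namespace RamIdeals

/-! ### Estimates for products of linear factors -/

section Basic

variable {C Γ : Type*} [Field C] [AddCommGroup Γ] [LinearOrder Γ] [IsOrderedAddMonoid Γ]
  (v : AddValuation C (WithTop Γ))

theorem map_ne_top {x : C} (hx : x ≠ 0) : v x ≠ ⊤ := fun h => hx ((AddValuation.top_iff v).1 h)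

theorem residue_eq_zero_iff (x : valRing v) :
    IsLocalRing.residue (valRing v) x = 0 ↔ 0 < v (x : C) := by
  have hx : 0 ≤ v (x : C) := x.2
  rw [IsLocalRing.residue_eq_zero_iff, IsLocalRing.mem_maximalIdeal, mem_nonunits_iff]
  constructor
  · intro h
    refine lt_of_le_of_ne hx fun h0 => h ?_
    have hne : (x : C) ≠ 0 := by
      intro h1
      rw [h1, AddValuation.map_zero] at h0
      exact absurd h0 (by simp)
    have hinv : v (x : C)⁻¹ = 0 := by
      have h1 : v (x : C) + v (x : C)⁻¹ = 0 := by
        rw [← AddValuation.map_mul, mul_inv_cancel₀ hne, AddValuation.map_one]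
      rwa [← h0, zero_add] at h1
    refine IsUnit.of_mul_eq_one (⟨(x : C)⁻¹, hinv.ge⟩ : valRing v) ?_
    ext
    exact mul_inv_cancel₀ hne
  · intro h hu
    obtain ⟨y, hy⟩ := hu.exists_right_inv
    have h1 : v (x : C) + v (y : C) = 0 := by
      rw [← AddValuation.map_mul, ← AddValuation.map_one v]
      exact congrArg v (congrArg Subtype.val hy)
    have h2 : 0 ≤ v (y : C) := y.2
    have h3 : 0 < v (x : C) + v (y : C) := add_pos_of_pos_of_nonneg h h2
    exact absurd h1 h3.ne'

/-- If `x` is at least as close to `a` as `r` is large, and no element of `t` is closer to `a` than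
that, then `∏ (x - z)` and `∏ (a - z)` are relatively as close as `x - a` and `r`. -/
theorem map_sub_add_le_prod_sub (x a r : C) (hr : v r ≤ v (x - a)) (t : Multiset C)
    (ht : ∀ z ∈ t, v (a - z) ≤ v r) :
    v (x - a) + v (t.map (a - ·)).prod ≤
      v ((t.map (x - ·)).prod - (t.map (a - ·)).prod) + v r := by
  induction t using Multiset.induction with
  | empty => simp
  | cons z t ih =>
    have ih := ih fun y hy => ht y (Multiset.mem_cons_of_mem hy)
    have hz := ht z (Multiset.mem_cons_self z t)
    simp only [Multiset.map_cons, Multiset.prod_cons]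
    set P := (t.map (a - ·)).prod
    set Q := (t.map (x - ·)).prod
    have hxz : v (a - z) ≤ v (x - z) := by
      have := v.map_add (x - a) (a - z)
      rw [sub_add_sub_cancel] at this
      exact (le_min (hz.trans hr) le_rfl).trans this
    have e : (x - z) * Q - (a - z) * P = (x - z) * (Q - P) + (x - a) * P := by ring
    rw [e]
    have h1 : v (x - a) + v ((a - z) * P) ≤ v ((x - z) * (Q - P)) + v r := by
      rw [v.map_mul, v.map_mul]
      calc v (x - a) + (v (a - z) + v P) = v (a - z) + (v (x - a) + v P) := add_left_comm _ _ _
        _ ≤ v (x - z) + (v (Q - P) + v r) := add_le_add hxz ih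
        _ = _ := (add_assoc _ _ _).symm
    have h2 : v (x - a) + v ((a - z) * P) ≤ v ((x - a) * P) + v r := by
      rw [v.map_mul, v.map_mul]
      calc v (x - a) + (v (a - z) + v P) = v (x - a) + v P + v (a - z) := by
            rw [add_comm (v (a - z)), add_assoc]
        _ ≤ _ := add_le_add le_rfl hz
    rcases le_total (v ((x - z) * (Q - P))) (v ((x - a) * P)) with h | h
    · exact h1.trans (add_le_add (v.map_le_add le_rfl h) le_rfl)
    · exact h2.trans (add_le_add (v.map_le_add h le_rfl) le_rfl)

/-- Up to sign, each coefficient times `α ^ i` is a sum of products choosing `α` or `z` from every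
factor. Both have value at least `v (α - z)`. -/
theorem map_prod_sub_le_coeff (α : C) (t : Multiset C) (ht : ∀ z ∈ t, v (α - z) ≤ v α) (i : ℕ) :
    v (t.map (α - ·)).prod ≤
      v ((t.map fun z => Polynomial.X - Polynomial.C z).prod.coeff i * α ^ i) := by
  induction t using Multiset.induction generalizing i with
  | empty =>
    rcases i with _ | i <;> simp [Polynomial.coeff_one]
  | cons z t ih =>
    have ih := ih fun y hy => ht y (Multiset.mem_cons_of_mem hy)
    have hz := ht z (Multiset.mem_cons_self z t)
    have hz' : v (α - z) ≤ v z := by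
      have := v.map_sub α (α - z)
      rw [sub_sub_cancel] at this
      exact (le_min hz le_rfl).trans this
    simp only [Multiset.map_cons, Multiset.prod_cons]
    set P := (t.map fun z => Polynomial.X - Polynomial.C z).prod
    have h2 : ∀ i, v ((α - z) * (t.map (α - ·)).prod) ≤ v (z * P.coeff i * α ^ i) := fun i => by
      rw [mul_assoc, v.map_mul, v.map_mul z]
      exact add_le_add hz' (ih i)
    rcases i with _ | i
    · have e : ((Polynomial.X - Polynomial.C z) * P).coeff 0 * α ^ 0 =
          -(z * P.coeff 0 * α ^ 0) := by
        simp [sub_mul]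
      rw [e, v.map_neg]
      exact h2 0
    · have e : ((Polynomial.X - Polynomial.C z) * P).coeff (i + 1) * α ^ (i + 1) =
          α * (P.coeff i * α ^ i) - z * P.coeff (i + 1) * α ^ (i + 1) := by
        simp only [sub_mul, Polynomial.coeff_sub, Polynomial.coeff_X_mul, Polynomial.coeff_C_mul]
        ring
      rw [e]
      refine le_trans (le_min ?_ (h2 (i + 1))) (v.map_sub _ _)
      rw [v.map_mul, v.map_mul α]
      exact add_le_add hz (ih i)

end Basic

/-! ### Invariance of the valuation under automorphisms -/

section Henselian

variable {K C Γ : Type*} [Field K] [Field C] [Algebra K C] [IsAlgClosure K C]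
  [AddCommGroup Γ] [LinearOrder Γ] [IsOrderedAddMonoid Γ] {v : AddValuation C (WithTop Γ)}

/-- Pulling the valuation ring of `C` back to `AlgebraicClosure K` along an isomorphism, or along
that isomorphism followed by `τ`, gives two extensions of the same ring. By uniqueness they
coincide. -/
theorem nonneg_map_algEquiv (hens : IsHenselian (restr v K)) (τ : C ≃ₐ[K] C) {x : C}
    (hx : 0 ≤ v x) : 0 ≤ v (τ x) := by
  let e := IsAlgClosure.equiv K (AlgebraicClosure K) C
  have h : ∀ f : AlgebraicClosure K →ₐ[K] C,
      ((valRing v).comap (f : AlgebraicClosure K →+* C)).comap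
        (algebraMap K (AlgebraicClosure K)) = valRing (restr v K) := by
    intro f
    ext y
    change 0 ≤ v (f (algebraMap K _ y)) ↔ 0 ≤ v (algebraMap K C y)
    rw [f.commutes]
  have h1 := hens.unique (h e) (h (e.trans τ))
  have h2 : e.symm x ∈ (valRing v).comap ((e : AlgebraicClosure K →ₐ[K] C) : _ →+* C) := by
    change 0 ≤ v (e (e.symm x))
    rwa [e.apply_symm_apply]
  rw [h1] at h2
  change 0 ≤ v (τ (e (e.symm x))) at h2
  rwa [e.apply_symm_apply] at h2

variable {Ω : IntermediateField K C}

theorem map_algEquiv_le_map_algEquiv (hens : IsHenselian (restr v K)) (σ : Ω ≃ₐ[K] Ω) {x y : Ω}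
    (h : v x ≤ v y) : v (σ x) ≤ v (σ y) := by
  have : Normal K C := IsAlgClosure.normal K C
  by_cases hx : x = 0
  · subst hx
    have hy : y = 0 := by simpa using h
    simp [hy]
  have hxy : 0 ≤ v ((y / x : Ω) : C) := by
    have h1 : v ((y / x : Ω) : C) + v (x : C) = v (y : C) := by
      rw [← v.map_mul, ← MulMemClass.coe_mul, div_mul_cancel₀ _ hx]
    have h2 : v (x : C) ≠ ⊤ := map_ne_top v (by simpa using hx)
    rw [← h1] at h
    exact (WithTop.add_le_add_iff_right h2).1 (by simpa using h)
  have h3 := nonneg_map_algEquiv hens (σ.liftNormal C) hxy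
  have h4 : σ.liftNormal C ((y / x : Ω) : C) = (σ (y / x) : Ω) :=
    σ.liftNormal_commutes C (y / x)
  rw [h4] at h3
  have h5 : v ((σ (y / x) : Ω) : C) + v (σ x : C) = v (σ y : C) := by
    rw [← v.map_mul, ← MulMemClass.coe_mul, ← map_mul, div_mul_cancel₀ _ hx]
  rw [← h5]
  exact le_add_of_nonneg_left h3

variable [FiniteDimensional K Ω]

/-- `σ` preserves the order of values and has finite order, so a strict increase from `x` to `σ x`
could never be undone when the powers of `σ` return to `x`. -/
theorem map_algEquiv_le (hens : IsHenselian (restr v K)) (σ : Ω ≃ₐ[K] Ω) (x : Ω) :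
    v (σ x) ≤ v x := by
  by_contra! hlt
  have h : ∀ k : ℕ, v (σ x) ≤ v ((σ ^ (k + 1)) x) := by
    intro k
    induction k with
    | zero => simp
    | succ k ih =>
      rw [pow_succ', AlgEquiv.mul_apply]
      exact map_algEquiv_le_map_algEquiv hens σ (hlt.le.trans ih)
  have h1 := h (orderOf σ - 1)
  rw [Nat.sub_add_cancel (orderOf_pos σ), pow_orderOf_eq_one, AlgEquiv.one_apply] at h1
  exact absurd h1 hlt.not_ge

/-- Over a henselian field the valuation is invariant under automorphisms. -/
theorem map_algEquiv (hens : IsHenselian (restr v K)) (σ : Ω ≃ₐ[K] Ω) (x : Ω) :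
    v (σ x) = v x := by
  refine le_antisymm (map_algEquiv_le hens σ x) ?_
  have := map_algEquiv_le hens σ.symm (σ x)
  rwa [σ.symm_apply_apply] at this

end Henselian

/-! ### Rank one and the archimedean property -/

section Archimedean

variable {F Γ : Type*} [Field F] [AddCommGroup Γ] [LinearOrder Γ] [IsOrderedAddMonoid Γ]

/-- An ordered abelian group with a single proper convex subgroup is archimedean. -/
theorem exists_le_nsmul_of_rank_eq_one {v : AddValuation F (WithTop Γ)} (hrank : rank v = 1)
    (g h : valueGroup v) (hg : 0 < g) : ∃ n : ℕ, h ≤ n • g := by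
  -- The convex subgroup generated by `g`. If it were proper, rank one would identify it with the
  -- trivial subgroup, although it contains `g`.
  let H : AddSubgroup (valueGroup v) :=
    { carrier := {x | ∃ n : ℕ, |x| ≤ n • g}
      add_mem' := by
        rintro x y ⟨n, hn⟩ ⟨m, hm⟩
        exact ⟨n + m, (abs_add_le x y).trans (by rw [add_nsmul]; exact add_le_add hn hm)⟩
      zero_mem' := ⟨0, by simp⟩
      neg_mem' := by
        rintro x ⟨n, hn⟩
        exact ⟨n, by rwa [abs_neg]⟩ }
  have hH : (H : Set (valueGroup v)).OrdConnected := by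
    refine ⟨?_⟩
    rintro x ⟨n, hn⟩ y ⟨m, hm⟩ z ⟨hxz, hzy⟩
    refine ⟨n + m, ?_⟩
    have hn' : 0 ≤ n • g := nsmul_nonneg hg.le n
    have hm' : 0 ≤ m • g := nsmul_nonneg hg.le m
    rw [add_nsmul, abs_le]
    constructor
    · calc -(n • g + m • g) ≤ -(n • g) := neg_le_neg (le_add_of_nonneg_right hm')
        _ ≤ x := (abs_le.1 hn).1
        _ ≤ z := hxz
    · calc z ≤ y := hzy
        _ ≤ m • g := (abs_le.1 hm).2
        _ ≤ n • g + m • g := le_add_of_nonneg_left hn'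
  have hgH : g ∈ H := ⟨1, by rw [abs_of_pos hg, one_nsmul]⟩
  by_cases hT : H = ⊤
  · obtain ⟨n, hn⟩ : h ∈ H := hT ▸ AddSubgroup.mem_top h
    exact ⟨n, (le_abs_self h).trans hn⟩
  · exfalso
    obtain ⟨L, hL⟩ := Set.encard_eq_one.1 hrank
    have h1 : H = L := by
      have : H ∈ ({L} : Set _) := hL ▸ ⟨hT, hH⟩
      exact this
    have h2 : (⊥ : AddSubgroup (valueGroup v)) = L := by
      have : (⊥ : AddSubgroup (valueGroup v)) ∈ ({L} : Set _) := by
        rw [← hL]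
        refine ⟨fun hb => hg.ne' ?_, ?_⟩
        · exact (AddSubgroup.mem_bot).1 (hb ▸ AddSubgroup.mem_top g)
        · rw [AddSubgroup.coe_bot]
          exact Set.ordConnected_singleton
      exact this
    rw [h1, ← h2, AddSubgroup.mem_bot] at hgH
    exact hg.ne' hgH

end Archimedean

/-! ### Valuation independence and the defect -/

section Defect

variable {K C Γ : Type*} [Field K] [Field C] [Algebra K C]
  [AddCommGroup Γ] [LinearOrder Γ] [IsOrderedAddMonoid Γ] (v : AddValuation C (WithTop Γ))

theorem residueSubfield_le (Ω : IntermediateField K C) :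
    residueSubfield v K ≤ residueSubfield v Ω := by
  rintro _ ⟨x, h, rfl⟩
  exact ⟨algebraMap K Ω x, h, rfl⟩

/-- A family of units of `Ω` with `Kv`-linearly dependent residues has a nontrivial combination,
with coefficients in the valuation ring of `K`, of positive value. -/
theorem exists_pos_map_sum_of_relfinrank_lt {Ω : IntermediateField K C}
    (hF : (residueSubfield v K).relfinrank (residueSubfield v Ω) ≠ 0)
    {ι : Type*} [Fintype ι] (u : ι → Ω) (hu : ∀ i, v (u i) = 0)
    (hcard : (residueSubfield v K).relfinrank (residueSubfield v Ω) < Fintype.card ι) :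
    ∃ x : ι → K, (∃ i, v (algebraMap K C (x i)) = 0) ∧
      0 < v (∑ i, algebraMap K C (x i) * u i) := by
  have hle := residueSubfield_le v Ω
  rw [Subfield.relfinrank_eq_finrank_of_le hle] at hF hcard
  have : Module.Finite (residueSubfield v K) (Subfield.extendScalars hle) :=
    Module.finite_of_finrank_pos (Nat.pos_of_ne_zero hF)
  let U : ι → valRing v := fun i => ⟨u i, (hu i).ge⟩
  let ξ : ι → Subfield.extendScalars hle := fun i =>
    ⟨IsLocalRing.residue (valRing v) (U i), ⟨u i, (hu i).ge, rfl⟩⟩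
  have hdep : ¬ LinearIndependent (residueSubfield v K) ξ := fun h =>
    hcard.not_ge h.fintype_card_le_finrank
  obtain ⟨r, hr, i, hi⟩ := Fintype.not_linearIndependent_iff.1 hdep
  choose x hx hxr using fun i => (r i).2
  let X : ι → valRing v := fun i => ⟨algebraMap K C (x i), hx i⟩
  refine ⟨x, ⟨i, ?_⟩, ?_⟩
  · by_contra h
    have h1 : 0 < v (algebraMap K C (x i)) := lt_of_le_of_ne (hx i) (Ne.symm h)
    have h2 := (residue_eq_zero_iff v (X i)).2 h1
    exact hi (Subtype.ext ((hxr i).symm.trans h2))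
  · have h1 : IsLocalRing.residue (valRing v) (∑ i, X i * U i) = 0 := by
      rw [map_sum]
      have h2 := congrArg (Subtype.val) hr
      rw [IntermediateField.coe_sum] at h2
      refine Eq.trans ?_ h2
      refine Finset.sum_congr rfl fun j _ => ?_
      rw [map_mul]
      change _ = (r j : IsLocalRing.ResidueField (valRing v)) * _
      rw [← hxr j]
    have h2 := (residue_eq_zero_iff v _).1 h1
    have h3 : ((∑ i, X i * U i : valRing v) : C) = ∑ i, algebraMap K C (x i) * u i := by
      rw [AddSubmonoidClass.coe_finsetSum]
      rfl
    rwa [h3] at h2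

/-- A valuation-independent family has at most `(vΩ : vK) [Ωv : Kv]` members, if this product of
possibly infinite quantities is finite. -/
theorem card_le_relIndex_mul_relfinrank {Ω : IntermediateField K C}
    (hE : (valueGroup (restr v K)).relIndex (valueGroup (restr v Ω)) ≠ 0)
    (hF : (residueSubfield v K).relfinrank (residueSubfield v Ω) ≠ 0)
    {ι : Type*} [Fintype ι] (y : ι → Ω) (hy : ∀ i, y i ≠ 0)
    (hind : ∀ (c : ι → K) (i : ι),
      v (∑ j, algebraMap K C (c j) * y j) ≤ v (algebraMap K C (c i) * y i)) :
    Fintype.card ι ≤ (valueGroup (restr v K)).relIndex (valueGroup (restr v Ω)) *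
      (residueSubfield v K).relfinrank (residueSubfield v Ω) := by
  classical
  by_contra! hlt
  let Q := valueGroup (restr v Ω) ⧸ (valueGroup (restr v K)).addSubgroupOf (valueGroup (restr v Ω))
  have hQ : Nat.card Q = (valueGroup (restr v K)).relIndex (valueGroup (restr v Ω)) := rfl
  have : Finite Q := Nat.finite_of_card_ne_zero (hQ ▸ hE)
  have : Fintype Q := Fintype.ofFinite Q
  have hyC : ∀ i, (y i : C) ≠ 0 := fun i => by simpa using hy i
  have hg : ∀ i, ∃ g : valueGroup (restr v Ω), v (y i) = ((g : Γ) : WithTop Γ) := fun i => by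
    obtain ⟨g, hg⟩ := WithTop.ne_top_iff_exists.1 (map_ne_top v (hyC i))
    exact ⟨⟨g, y i, hg.symm⟩, hg.symm⟩
  choose g hg using hg
  let q : ι → Q := fun i => QuotientAddGroup.mk (g i)
  rw [← hQ, Nat.card_eq_fintype_card] at hlt
  -- Pigeonhole: some coset of `vK` contains the values of more members than the residue degree.
  obtain ⟨q₀, hq₀⟩ := Fintype.exists_lt_card_fiber_of_mul_lt_card q hlt
  rw [← Fintype.card_subtype] at hq₀
  obtain ⟨i₀⟩ : Nonempty {i // q i = q₀} := Fintype.card_pos_iff.1 ((Nat.zero_le _).trans_lt hq₀)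
  -- Scaling by `K` gives these members the common value `v (y i₀)`. Divided by `y i₀` they become
  -- units with dependent residues.
  have hc : ∀ i : {i // q i = q₀}, ∃ c : K,
      v (algebraMap K C c * (y i : C)) = v (y i₀ : C) := fun i => by
    have h1 : (QuotientAddGroup.mk (g i) : Q) = QuotientAddGroup.mk (g i₀) := i.2.trans i₀.2.symm
    rw [QuotientAddGroup.eq, AddSubgroup.mem_addSubgroupOf] at h1
    obtain ⟨c, hc⟩ := h1
    refine ⟨c, ?_⟩
    have hc' : v (algebraMap K C c) =
      ((-(g i : Γ) + (g i₀ : Γ) : Γ) : WithTop Γ) := hc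
    rw [v.map_mul, hc', hg, hg, ← WithTop.coe_add, neg_add_cancel_comm]
  choose c hc using hc
  have hu : ∀ i : {i // q i = q₀},
      v ((algebraMap K Ω (c i) * y i / y i₀ : Ω) : C) = 0 := fun i => by
    have h1 : v ((algebraMap K Ω (c i) * y i / y i₀ : Ω) : C) + v (y i₀ : C) = 0 + v (y i₀ : C) := by
      rw [← v.map_mul, ← MulMemClass.coe_mul, div_mul_cancel₀ _ (hy _), zero_add, ← hc i]
      rfl
    exact (WithTop.add_right_inj (map_ne_top v (hyC i₀))).1 h1
  obtain ⟨x, ⟨i, hi⟩, hpos⟩ := exists_pos_map_sum_of_relfinrank_lt v hF _ hu hq₀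
  let d : ι → K := fun j => if h : q j = q₀ then x ⟨j, h⟩ * c ⟨j, h⟩ else 0
  have hd : ∀ j : {i // q i = q₀}, d j = x j * c j := fun j => dif_pos j.2
  have hsum : ∑ j, algebraMap K C (d j) * y j =
      (∑ j, algebraMap K C (x j) * ((algebraMap K Ω (c j) * y j / y i₀ : Ω) : C)) * y i₀ := by
    rw [Finset.sum_mul]
    symm
    refine Fintype.sum_of_injective (Subtype.val) Subtype.val_injective _ _ ?_ ?_
    · intro j hj
      have : d j = 0 := dif_neg fun h => hj ⟨⟨j, h⟩, rfl⟩
      rw [this, map_zero, zero_mul]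
    · intro j
      rw [hd, map_mul, mul_assoc, ← MulMemClass.coe_mul, div_mul_cancel₀ _ (hy _), mul_assoc]
      rfl
  -- The combination has value above `v (y i₀)`, yet its term at `i` has exactly that value,
  -- contradicting independence.
  have h1 := hind d i
  rw [hsum, hd, map_mul (algebraMap K C), mul_assoc, v.map_mul (algebraMap K C (x i)), hi, hc,
    zero_add, v.map_mul] at h1
  have h2 := (WithTop.add_le_add_iff_right (map_ne_top v (hyC i₀))).1
    (h1.trans (zero_add _).ge)
  exact hpos.not_ge h2

theorem deg_le_natDegree {f : Polynomial K} (hf : f ≠ 0) {z : C}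
    (hz : z ∈ (f.map (algebraMap K C)).roots) : deg K z ≤ f.natDegree := by
  refine Polynomial.natDegree_le_of_dvd (minpoly.dvd K z ?_) hf
  rw [Polynomial.mem_roots_map hf] at hz
  exact hz

theorem deg_add_algebraMap (z : C) (b : K) : deg K (z + algebraMap K C b) = deg K z := by
  rw [deg, deg, minpoly.add_algebraMap, Polynomial.natDegree_comp, Polynomial.natDegree_X_sub_C,
    mul_one]

variable [IsAlgClosed C]

/-- If nothing of degree less than `n` is closer to `α` than `0`, then polynomials of degree less
than `n` take at `α` the least value of their monomials. -/
theorem map_aeval_le_map_coeff_mul_pow {α : C} {n : ℕ}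
    (hα : ∀ z : C, deg K z < n → v (α - z) ≤ v α) (f : Polynomial K) (hf : f.natDegree < n)
    (i : ℕ) : v (Polynomial.aeval α f) ≤ v (algebraMap K C (f.coeff i) * α ^ i) := by
  rcases eq_or_ne f 0 with rfl | hf0
  · simp
  have hs := (IsAlgClosed.splits (f.map (algebraMap K C))).eq_prod_roots
  set t := (f.map (algebraMap K C)).roots with ht
  have h := map_prod_sub_le_coeff v α t
    (fun z hz => hα z ((deg_le_natDegree hf0 hz).trans_lt hf)) i
  have h1 : Polynomial.aeval α f =
      (f.map (algebraMap K C)).leadingCoeff * (t.map (α - ·)).prod := by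
    rw [Polynomial.aeval_def, ← Polynomial.eval_map,
      (IsAlgClosed.splits (f.map (algebraMap K C))).eval_eq_prod_roots]
  have h2 : algebraMap K C (f.coeff i) = (f.map (algebraMap K C)).leadingCoeff *
      (t.map fun z => Polynomial.X - Polynomial.C z).prod.coeff i := by
    rw [← Polynomial.coeff_map, ← Polynomial.coeff_C_mul, ← hs]
  rw [h1, h2, mul_assoc, v.map_mul, v.map_mul (Polynomial.leadingCoeff _)]
  exact add_le_add le_rfl h

/-- Otherwise the powers of `α = a - b` below the degree are valuation-independent, and counting
them contradicts the defect. -/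
theorem map_sub_lt_of_one_lt_defect {Ω : IntermediateField K C} [FiniteDimensional K Ω]
    (hdefect : 1 < defect K v Ω) {a : C} (hgen : K⟮a⟯ = Ω) (b : K) :
    ∃ z : C, deg K z < deg K a ∧ v (a - algebraMap K C b) < v (a - z) := by
  by_contra! hmax
  set e := (valueGroup (restr v K)).relIndex (valueGroup (restr v Ω)) with he
  set f := (residueSubfield v K).relfinrank (residueSubfield v Ω) with hf
  have hdef : defect K v Ω = (Module.finrank K Ω : ℚ) / (e * f) := rfl
  rw [hdef] at hdefect
  -- An infinite index or degree is recorded as `0`, and division by zero would make the defect `0`.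
  have he0 : e ≠ 0 := fun h => by simp [h] at hdefect; linarith
  have hf0 : f ≠ 0 := fun h => by simp [h] at hdefect; linarith
  have haΩ : a ∈ Ω := hgen ▸ IntermediateField.mem_adjoin_simple_self K a
  have hint : IsIntegral K a := (IsIntegral.of_finite K (⟨a, haΩ⟩ : Ω)).map Ω.val
  have hfin : Module.finrank K Ω = deg K a := by
    rw [← hgen]; exact IntermediateField.adjoin.finrank hint
  set α : C := a - algebraMap K C b with hαdef
  have hα : ∀ z : C, deg K z < deg K a → v (α - z) ≤ v α := fun z hz => by
    have := hmax (z + algebraMap K C b) (by rwa [deg_add_algebraMap])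
    rwa [← sub_sub, sub_right_comm] at this
  have hαΩ : α ∈ Ω := Ω.sub_mem haΩ (Ω.algebraMap_mem b)
  have hlt : e * f < Module.finrank K Ω := by
    have h1 : (0 : ℚ) < e * f := by positivity
    rw [lt_div_iff₀ h1, one_mul] at hdefect
    exact_mod_cast hdefect
  have hα0 : (⟨α, hαΩ⟩ : Ω) ≠ 0 := by
    intro h
    have h1 : a = algebraMap K C b := sub_eq_zero.1 (congrArg Subtype.val h)
    have h2 : deg K a = 1 := minpoly.natDegree_eq_one_iff.2 ⟨b, h1.symm⟩
    have h3 : 0 < e * f := by positivity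
    omega
  have hcard := card_le_relIndex_mul_relfinrank v he0 hf0
    (fun i : Fin (deg K a) => (⟨α, hαΩ⟩ : Ω) ^ (i : ℕ)) (fun i => pow_ne_zero _ hα0) ?_
  · rw [Fintype.card_fin, ← hfin] at hcard
    exact hlt.not_ge hcard
  · intro c i
    have hpos : 0 < deg K a := i.pos
    let P : Polynomial K := ∑ j : Fin (deg K a), Polynomial.C (c j) * Polynomial.X ^ (j : ℕ)
    have hP : P.natDegree < deg K a := by
      refine lt_of_le_of_lt (Polynomial.natDegree_sum_le_of_forall_le _ _
        (n := deg K a - 1) fun j _ => ?_) (by omega)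
      exact (Polynomial.natDegree_C_mul_X_pow_le _ _).trans (by have := j.2; omega)
    have hc : P.coeff i = c i := by
      simp [P, Polynomial.coeff_C_mul, Polynomial.coeff_X_pow,
        Fin.val_inj]
    have h := map_aeval_le_map_coeff_mul_pow v hα P hP i
    rw [hc] at h
    simpa [P] using h

end Defect

/-! ### Pure generators and their approximation from `K` -/

section Pure

variable {K : Type*} {C : Type u} {Γ : Type*} [Field K] [Field C] [Algebra K C]
  [AddCommGroup Γ] [LinearOrder Γ] [IsOrderedAddMonoid Γ] {v : AddValuation C (WithTop Γ)}

theorem IsPure.exists_isOkutsuSequence {a : C} (hpure : IsPure K v a) :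
    ∃ A d, IsOkutsuSequence K v a 1 A d ∧ d 0 = deg K a ∧ d 1 = 1 := by
  have hne : {n | ∃ A d, IsOkutsuSequence K v a n A d}.Nonempty :=
    -- The infimum of the empty set is `0`, so depth `1` guarantees that an Okutsu sequence exists.
    Nat.nonempty_of_pos_sInf (by
      have h : sInf {n | ∃ A d, IsOkutsuSequence K v a n A d} = 1 := hpure
      omega)
  have h := Nat.sInf_mem hne
  rw [show sInf {n | ∃ A d, IsOkutsuSequence K v a n A d} = 1 from hpure] at h
  obtain ⟨A, d, hA⟩ := h
  exact ⟨A, d, hA, (hA.common_degree 0 zero_le_one a (hA.first ▸ rfl)).symm, hA.degree_last⟩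

theorem deg_eq_one_iff {z : C} : deg K z = 1 ↔ ∃ y : K, algebraMap K C y = z :=
  minpoly.natDegree_eq_one_iff

/-- Elements of smaller degree than a pure element are no closer to it than elements of `K`. -/
theorem IsPure.exists_le {a : C} (hpure : IsPure K v a) {z : C} (hz : deg K z < deg K a) :
    ∃ y : K, v (a - z) ≤ v (a - algebraMap K C y) := by
  obtain ⟨A, d, hA, h0, h1⟩ := hpure.exists_isOkutsuSequence
  obtain ⟨y, hy, h⟩ := hA.approx 0 one_pos z (h0.symm ▸ hz)
  obtain ⟨y, rfl⟩ := deg_eq_one_iff.1 ((hA.common_degree 1 le_rfl y hy).trans h1)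
  exact ⟨y, h⟩

theorem IsPure.exists_lt [IsAlgClosed C] {Ω : IntermediateField K C} [FiniteDimensional K Ω]
    (hdefect : 1 < defect K v Ω) {a : C} (hgen : K⟮a⟯ = Ω) (hpure : IsPure K v a) (b : K) :
    ∃ y : K, v (a - algebraMap K C b) < v (a - algebraMap K C y) := by
  obtain ⟨z, hz, hlt⟩ := map_sub_lt_of_one_lt_defect v hdefect hgen b
  obtain ⟨y, hy⟩ := hpure.exists_le hz
  exact ⟨y, hlt.trans_le hy⟩

theorem exists_natDegree_lt_aeval_eq {Ω : IntermediateField K C} [FiniteDimensional K Ω]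
    {a : C} (hgen : K⟮a⟯ = Ω) (z : Ω) :
    ∃ f : Polynomial K, f.natDegree < deg K a ∧ Polynomial.aeval a f = z := by
  have haΩ : a ∈ Ω := hgen ▸ IntermediateField.mem_adjoin_simple_self K a
  have hint : IsIntegral K a := (IsIntegral.of_finite K (⟨a, haΩ⟩ : Ω)).map Ω.val
  have hz : (z : C) ∈ K⟮a⟯.toSubalgebra := hgen ▸ z.2
  rw [IntermediateField.adjoin_simple_toSubalgebra_of_isAlgebraic hint.isAlgebraic,
    Algebra.adjoin_singleton_eq_range_aeval] at hz
  obtain ⟨f, hf⟩ := hz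
  refine ⟨f %ₘ minpoly K a, Polynomial.natDegree_modByMonic_lt _ (minpoly.monic hint)
    (minpoly.ne_one K a), ?_⟩
  rw [← hf, Polynomial.aeval_modByMonic_eq_self_of_root (minpoly.aeval K a)]
  rfl

end Pure

/-! ### Ramification ideals and distances of conjugates -/

section Ramification

variable {K : Type*} {C : Type u} {Γ : Type*} [Field K] [Field C] [Algebra K C]
  [AddCommGroup Γ] [LinearOrder Γ] [IsOrderedAddMonoid Γ] {v : AddValuation C (WithTop Γ)}

theorem exists_forall_mem_map_sub_le {a : C} {t : Multiset C}
    (h : ∀ z ∈ t, ∃ y : K, v (a - z) ≤ v (a - algebraMap K C y)) :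
    ∃ y : K, ∀ z ∈ t, v (a - z) ≤ v (a - algebraMap K C y) := by
  induction t using Multiset.induction with
  | empty => exact ⟨0, by simp⟩
  | cons z t ih =>
    obtain ⟨y, hy⟩ := ih fun x hx => h x (Multiset.mem_cons_of_mem hx)
    obtain ⟨w, hw⟩ := h z (Multiset.mem_cons_self z t)
    rcases le_total (v (a - algebraMap K C y)) (v (a - algebraMap K C w)) with hyw | hyw
    · refine ⟨w, fun x hx => ?_⟩
      rcases Multiset.mem_cons.1 hx with rfl | hx
      exacts [hw, (hy x hx).trans hyw]
    · refine ⟨y, fun x hx => ?_⟩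
      rcases Multiset.mem_cons.1 hx with rfl | hx
      exacts [hw.trans hyw, hy x hx]

variable (K v) in
/-- The ideal of all `x` with `s - v (a - y) ≤ v x` for some `y ∈ K`. -/
def distIdeal (Ω : IntermediateField K C) (a : C) (s : WithTop Γ) :
    Ideal (valRing (restr v Ω)) where
  carrier := {x | ∃ y : K, s ≤ v ((x : Ω) : C) + v (a - algebraMap K C y)}
  add_mem' := by
    rintro x x' ⟨y, hy⟩ ⟨y', hy'⟩
    obtain ⟨w, hw, hw'⟩ : ∃ w : K, v (a - algebraMap K C y) ≤ v (a - algebraMap K C w) ∧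
        v (a - algebraMap K C y') ≤ v (a - algebraMap K C w) := by
      rcases le_total (v (a - algebraMap K C y)) (v (a - algebraMap K C y')) with h | h
      exacts [⟨y', h, le_rfl⟩, ⟨y, le_rfl, h⟩]
    refine ⟨w, ?_⟩
    change s ≤ v (((x : Ω) : C) + ((x' : Ω) : C)) + _
    rcases le_total (v ((x : Ω) : C)) (v ((x' : Ω) : C)) with h | h
    · exact hy.trans (add_le_add (v.map_le_add le_rfl h) hw)
    · exact hy'.trans (add_le_add (v.map_le_add h le_rfl) hw')
  zero_mem' := ⟨0, by simp⟩
  smul_mem' := by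
    rintro c x ⟨y, hy⟩
    refine ⟨y, hy.trans (add_le_add ?_ le_rfl)⟩
    change _ ≤ v (((c : Ω) : C) * ((x : Ω) : C))
    rw [v.map_mul]
    exact le_add_of_nonneg_left c.2

theorem mem_distIdeal {Ω : IntermediateField K C} {a : C} {s : WithTop Γ}
    {x : valRing (restr v Ω)} :
    x ∈ distIdeal K v Ω a s ↔ ∃ y : K, s ≤ v ((x : Ω) : C) + v (a - algebraMap K C y) := Iff.rfl

theorem distIdeal_le_maximalIdeal {Ω : IntermediateField K C} {α : Ω} {s : WithTop Γ}
    (hs : ∀ y : K, v ((α : C) - algebraMap K C y) < s) :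
    distIdeal K v Ω α s ≤ IsLocalRing.maximalIdeal (valRing (restr v Ω)) := by
  rintro x ⟨y, hy⟩
  rw [← IsLocalRing.residue_eq_zero_iff, residue_eq_zero_iff (restr v Ω)]
  by_contra h
  have h0 : v ((x : Ω) : C) ≤ 0 := not_lt.1 h
  refine (hs y).not_ge (hy.trans ?_)
  calc _ ≤ 0 + v ((α : C) - algebraMap K C y) := add_le_add h0 le_rfl
    _ = _ := zero_add _

/-- Multiplication by the finite index carries `vΩ` into the archimedean group `vK`. -/
theorem exists_le_nsmul_of_relIndex_ne_zero {Ω : IntermediateField K C} (hrank : rank (restr v K) = 1)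
    (hE : (valueGroup (restr v K)).relIndex (valueGroup (restr v Ω)) ≠ 0) {γ δ : Γ}
    (hγ : γ ∈ valueGroup (restr v Ω)) (hδ : δ ∈ valueGroup (restr v Ω)) (hpos : 0 < δ) :
    ∃ n : ℕ, γ ≤ n • δ := by
  set e := (valueGroup (restr v K)).relIndex (valueGroup (restr v Ω)) with he
  have hmem : ∀ β ∈ valueGroup (restr v Ω), e • β ∈ valueGroup (restr v K) := fun β hβ =>
    AddSubgroup.nsmul_index_mem
      ((valueGroup (restr v K)).addSubgroupOf (valueGroup (restr v Ω))) ⟨β, hβ⟩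
  obtain ⟨n, hn⟩ := exists_le_nsmul_of_rank_eq_one hrank ⟨e • δ, hmem δ hδ⟩ ⟨e • γ, hmem γ hγ⟩
    (nsmul_pos hpos hE)
  refine ⟨n, ?_⟩
  have hn' : e • γ ≤ n • e • δ := hn
  rw [← mul_nsmul', mul_nsmul] at hn'
  exact (nsmul_le_nsmul_iff_right hE).1 hn'

theorem exists_ne_one_of_bot_lt_ramIdeal {Ω : IntermediateField K C}
    {H : Subgroup (Ω ≃ₐ[K] Ω)} (h : ⊥ < ramIdeal v Ω H) :
    ∃ σ ∈ H, σ ≠ 1 := by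
  by_contra! hH
  refine h.not_ge (Ideal.span_le.2 ?_)
  rintro x ⟨σ, hσ, z, hz, hx⟩
  rw [hH σ hσ, AlgEquiv.one_apply, div_self hz, sub_self] at hx
  exact Subtype.ext hx

theorem algEquiv_apply_ne {Ω : IntermediateField K C} [FiniteDimensional K Ω] {α : Ω}
    (hgen : K⟮(α : C)⟯ = Ω) {σ : Ω ≃ₐ[K] Ω} (hσ : σ ≠ 1) : σ α ≠ α := by
  intro h
  refine hσ (AlgEquiv.ext fun z => ?_)
  obtain ⟨f, -, hf⟩ := exists_natDegree_lt_aeval_eq hgen z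
  have h1 : Polynomial.aeval α f = z :=
    Subtype.ext ((Polynomial.aeval_algHom_apply Ω.val α f).symm.trans hf)
  rw [AlgEquiv.one_apply, ← h1, ← Polynomial.aeval_algHom_apply σ]
  exact congrArg (fun x => Polynomial.aeval x f) h

variable [IsAlgClosure K C] {Ω : IntermediateField K C} {α : Ω}

theorem mem_conjDist_iff [Normal K Ω] {s : WithTop Γ} :
    s ∈ conjDist K v (α : C) ↔ ∃ σ : Ω ≃ₐ[K] Ω, σ α ≠ α ∧ v ((α : C) - σ α) = s := by
  have : Normal K C := IsAlgClosure.normal K C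
  constructor
  · rintro ⟨a', hne, hconj, rfl⟩
    obtain ⟨τ, hτ⟩ := hconj.symm.exists_algEquiv
    have h : ((τ.restrictNormal Ω α : Ω) : C) = a' :=
      (τ.restrictNormal_commutes Ω α).trans hτ
    exact ⟨τ.restrictNormal Ω, fun h' => hne (by rw [← h, h']), by rw [h]⟩
  · rintro ⟨σ, hne, rfl⟩
    refine ⟨σ α, fun h => hne (Subtype.ext h), ?_, rfl⟩
    exact (isConjRoot_algHom_iff Ω.val).2 (isConjRoot_of_algEquiv α σ)

variable [FiniteDimensional K Ω]

/-- No element of `K` is closer to `α` than the conjugates of `α` are. -/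
theorem map_sub_algebraMap_le (hens : IsHenselian (restr v K)) (σ : Ω ≃ₐ[K] Ω) (y : K) :
    v ((α : C) - algebraMap K C y) ≤ v ((α : C) - σ α) := by
  have h := map_algEquiv hens σ (α - algebraMap K Ω y)
  rw [map_sub, AlgEquiv.commutes] at h
  have h2 : v (((σ α : Ω) : C) - algebraMap K C y) = v ((α : C) - algebraMap K C y) := h
  have h3 := v.map_sub ((α : C) - algebraMap K C y) (((σ α : Ω) : C) - algebraMap K C y)
  rwa [h2, min_self, sub_sub_sub_cancel_right] at h3

/-- With `z = f(α)` and `σ z = f(σ α)`, all roots of `f` have smaller degree than `α`, so a single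
`y ∈ K` is at least as close to `α` as each of them. This bounds every generator of a ramification
ideal. -/
theorem exists_map_sub_le_map_div_sub_one (hens : IsHenselian (restr v K))
    (hgen : K⟮(α : C)⟯ = Ω)
    (happ : ∀ z : C, deg K z < deg K (α : C) →
      ∃ y : K, v ((α : C) - z) ≤ v ((α : C) - algebraMap K C y))
    (σ : Ω ≃ₐ[K] Ω) {z : Ω} (hz : z ≠ 0) :
    ∃ y : K, v ((α : C) - σ α) ≤
      v ((σ z / z - 1 : Ω) : C) + v ((α : C) - algebraMap K C y) := by
  have : IsAlgClosed C := IsAlgClosure.isAlgClosed K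
  obtain ⟨f, hfdeg, hf⟩ := exists_natDegree_lt_aeval_eq hgen z
  have hf0 : f ≠ 0 := by
    rintro rfl
    exact hz (Subtype.ext (by simpa using hf.symm))
  have hσf : Polynomial.aeval ((σ α : Ω) : C) f = (σ z : Ω) := by
    have h1 : Polynomial.aeval α f = z := by
      apply Subtype.ext
      rw [← hf]
      exact (Polynomial.aeval_algHom_apply Ω.val α f).symm
    rw [← h1, ← Polynomial.aeval_algHom_apply σ]
    exact Polynomial.aeval_algHom_apply Ω.val (σ α) f
  set t := (f.map (algebraMap K C)).roots
  have hev : ∀ x : C, Polynomial.aeval x f =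
      (f.map (algebraMap K C)).leadingCoeff * (t.map (x - ·)).prod := fun x => by
    rw [Polynomial.aeval_def, ← Polynomial.eval_map,
      (IsAlgClosed.splits (f.map (algebraMap K C))).eval_eq_prod_roots]
  obtain ⟨y, hy⟩ := exists_forall_mem_map_sub_le (K := K) (v := v) (a := (α : C)) (t := t)
    fun x hx => happ x ((deg_le_natDegree hf0 hx).trans_lt hfdeg)
  refine ⟨y, ?_⟩
  have h := map_sub_add_le_prod_sub v ((σ α : Ω) : C) α ((α : C) - algebraMap K C y)
    (by rw [v.map_sub_swap (σ α : C)]; exact map_sub_algebraMap_le hens σ y) t hy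
  rw [v.map_sub_swap (σ α : C)] at h
  have hzC : (z : C) ≠ 0 := by simpa using hz
  refine (WithTop.add_le_add_iff_right (map_ne_top v hzC)).1 ?_
  have e1 : ((σ z / z - 1 : Ω) : C) * z = (σ z : Ω) - z := by
    rw [← MulMemClass.coe_mul, sub_mul, div_mul_cancel₀ _ hz, one_mul]
    rfl
  have e2 := (v.map_mul ((σ z / z - 1 : Ω) : C) z).symm.trans (congrArg v e1)
  rw [add_right_comm, e2, ← hf, ← hσf, hev, hev, ← mul_sub, v.map_mul, v.map_mul,
    add_left_comm, add_assoc]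
  exact add_le_add le_rfl h

/-- Taking `z = α - y` gives `σ z / z - 1 = (σ α - α) / (α - y)`, so the preceding bound is sharp.
-/
theorem exists_mem_ramIdeal_map_add_eq (hens : IsHenselian (restr v K))
    (σ : Ω ≃ₐ[K] Ω) {y : K} (hy : (α : C) - algebraMap K C y ≠ 0) :
    ∃ x : valRing (restr v Ω),
      v ((x : Ω) : C) + v ((α : C) - algebraMap K C y) = v ((α : C) - σ α) ∧
      ∀ H : Subgroup (Ω ≃ₐ[K] Ω), σ ∈ H → x ∈ ramIdeal v Ω H := by
  have hβ : α - algebraMap K Ω y ≠ 0 := fun h => hy (congrArg Subtype.val h)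
  have h1 : v ((σ (α - algebraMap K Ω y) / (α - algebraMap K Ω y) - 1 : Ω) : C) +
      v ((α : C) - algebraMap K C y) = v ((α : C) - σ α) := by
    have e : (σ (α - algebraMap K Ω y) / (α - algebraMap K Ω y) - 1) *
        (α - algebraMap K Ω y) = σ α - α := by
      rw [sub_mul, div_mul_cancel₀ _ hβ, map_sub, AlgEquiv.commutes]
      ring
    rw [v.map_sub_swap (α : C) (σ α : Ω)]
    exact (v.map_mul _ _).symm.trans (congrArg (fun x : Ω => v (x : C)) e)
  have h2 : 0 ≤ v ((σ (α - algebraMap K Ω y) / (α - algebraMap K Ω y) - 1 : Ω) : C) := by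
    refine (WithTop.add_le_add_iff_right (map_ne_top v hy)).1 ?_
    rw [h1, zero_add]
    exact map_sub_algebraMap_le hens σ y
  exact ⟨⟨_, h2⟩, h1, fun H hσ => Ideal.subset_span ⟨σ, hσ, _, hβ, rfl⟩⟩

/-- The ramification ideal of `H` is determined by the least distance of `α` from its conjugates
under `H`. -/
theorem ramIdeal_eq_distIdeal (hens : IsHenselian (restr v K)) (hgen : K⟮(α : C)⟯ = Ω)
    (happ : ∀ z : C, deg K z < deg K (α : C) →
      ∃ y : K, v ((α : C) - z) ≤ v ((α : C) - algebraMap K C y))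
    (hα : ∀ y : K, (α : C) - algebraMap K C y ≠ 0)
    {H : Subgroup (Ω ≃ₐ[K] Ω)} {σ : Ω ≃ₐ[K] Ω} (hσ : σ ∈ H)
    (hmin : ∀ τ ∈ H, v ((α : C) - σ α) ≤ v ((α : C) - τ α)) :
    ramIdeal v Ω H = distIdeal K v Ω α (v ((α : C) - σ α)) := by
  refine le_antisymm (Ideal.span_le.2 ?_) ?_
  · rintro x ⟨τ, hτ, z, hz, hx⟩
    obtain ⟨y, hy⟩ := exists_map_sub_le_map_div_sub_one hens hgen happ τ hz
    refine ⟨y, (hmin τ hτ).trans ?_⟩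
    rwa [hx]
  · rintro x ⟨y, hy⟩
    obtain ⟨g, hg, hgH⟩ := exists_mem_ramIdeal_map_add_eq hens σ (hα y)
    have hgx : v ((g : Ω) : C) ≤ v ((x : Ω) : C) := by
      rw [← hg] at hy
      exact (WithTop.add_le_add_iff_right (map_ne_top v (hα y))).1 hy
    -- `g` vanishes exactly when `σ` fixes `α`; otherwise `g` divides `x` in the valuation ring.
    by_cases hg0 : (g : Ω) = 0
    · have : x = 0 := by
        rw [hg0] at hgx
        simp only [ZeroMemClass.coe_zero, AddValuation.map_zero, top_le_iff,
          AddValuation.top_iff, ZeroMemClass.coe_eq_zero] at hgx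
        exact hgx
      rw [this]
      exact zero_mem _
    · have hq : ((x : Ω) / g) * g = x := div_mul_cancel₀ _ hg0
      have hq0 : 0 ≤ v (((x : Ω) / g : Ω) : C) := by
        have hg0' : ((g : Ω) : C) ≠ 0 := by simpa using hg0
        refine (WithTop.add_le_add_iff_right (map_ne_top v hg0')).1 ?_
        rw [← v.map_mul, ← MulMemClass.coe_mul, hq, zero_add]
        exact hgx
      have e : x = (⟨(x : Ω) / g, hq0⟩ : valRing (restr v Ω)) * g := Subtype.ext hq.symm
      rw [e]
      exact Ideal.mul_mem_left _ _ (hgH H hσ)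

theorem bot_lt_distIdeal (hens : IsHenselian (restr v K))
    (hα : ∀ y : K, (α : C) - algebraMap K C y ≠ 0) {σ : Ω ≃ₐ[K] Ω} (hσ : σ α ≠ α) :
    ⊥ < distIdeal K v Ω α (v ((α : C) - σ α)) := by
  obtain ⟨x, hx, -⟩ := exists_mem_ramIdeal_map_add_eq hens σ (hα 0)
  refine lt_of_le_of_ne bot_le fun h => ?_
  have h1 : x ∈ distIdeal K v Ω α (v ((α : C) - σ α)) := ⟨0, hx.ge⟩
  rw [← h, Ideal.mem_bot] at h1
  rw [h1] at hx
  have h2 : v ((α : C) - (σ α : Ω)) ≠ ⊤ :=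
    map_ne_top v (sub_ne_zero.2 fun h => hσ (Subtype.ext h.symm))
  exact h2 (by simpa using hx.symm)

/-- An inclusion would let every distance from `α` to `K` be improved by the fixed positive amount
`p' - p`. Iterating eventually exceeds `p`, which bounds all these distances. -/
theorem not_distIdeal_le_distIdeal (hens : IsHenselian (restr v K))
    (hrank : rank (restr v K) = 1)
    (hE : (valueGroup (restr v K)).relIndex (valueGroup (restr v Ω)) ≠ 0)
    {σ τ : Ω ≃ₐ[K] Ω} (hτ : τ α ≠ α) (hlt : v ((α : C) - σ α) < v ((α : C) - τ α))
    (hs : ∀ y : K, v ((α : C) - algebraMap K C y) < v ((α : C) - σ α)) :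
    ¬ distIdeal K v Ω α (v ((α : C) - σ α)) ≤ distIdeal K v Ω α (v ((α : C) - τ α)) := by
  intro hle
  have hg : ∀ y : K, ∃ g ∈ valueGroup (restr v Ω), v ((α : C) - algebraMap K C y) = (g : Γ) :=
    fun y => by
      obtain ⟨g, hg⟩ := WithTop.ne_top_iff_exists.1 (hs y).ne_top
      exact ⟨g, ⟨α - algebraMap K Ω y, hg.symm⟩, hg.symm⟩
  choose g hgΩ hg using hg
  obtain ⟨p, hp⟩ := WithTop.ne_top_iff_exists.1 hlt.ne_top
  obtain ⟨p', hp'⟩ := WithTop.ne_top_iff_exists.1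
    (map_ne_top v (sub_ne_zero.2 fun h => hτ (Subtype.ext h.symm)) :
      v ((α : C) - (τ α : Ω)) ≠ ⊤)
  have hpΩ : p ∈ valueGroup (restr v Ω) := ⟨α - σ α, hp.symm⟩
  have hpΩ' : p' ∈ valueGroup (restr v Ω) := ⟨α - τ α, hp'.symm⟩
  rw [← hp, ← hp', WithTop.coe_lt_coe] at hlt
  have hstep : ∀ y : K, ∃ y' : K, g y + (p' - p) ≤ g y' := fun y => by
    obtain ⟨x, hx, -⟩ := exists_mem_ramIdeal_map_add_eq hens σ (y := y)
      (fun h => (hs y).ne_top (by rw [h, v.map_zero]))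
    obtain ⟨y', hy'⟩ := hle (show x ∈ distIdeal K v Ω α (v ((α : C) - σ α)) from ⟨y, hx.ge⟩)
    refine ⟨y', ?_⟩
    have hxt : v ((x : Ω) : C) ≠ ⊤ := fun h => by
      rw [h, top_add, ← hp] at hx
      exact WithTop.coe_ne_top hx.symm
    obtain ⟨q, hq⟩ := WithTop.ne_top_iff_exists.1 hxt
    rw [← hq, hg, ← hp, ← WithTop.coe_add, WithTop.coe_inj] at hx
    rw [← hq, hg, ← hp', ← WithTop.coe_add, WithTop.coe_le_coe] at hy'
    calc g y + (p' - p) = p' - q := by rw [← hx]; abel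
      _ ≤ g y' := by rwa [sub_le_iff_le_add']
  have hiter : ∀ n : ℕ, ∃ y : K, g 0 + n • (p' - p) ≤ g y := fun n => by
    induction n with
    | zero => exact ⟨0, by simp⟩
    | succ n ih =>
      obtain ⟨y, hy⟩ := ih
      obtain ⟨y', hy'⟩ := hstep y
      refine ⟨y', le_trans ?_ hy'⟩
      rw [succ_nsmul, ← add_assoc]
      exact add_le_add hy le_rfl
  obtain ⟨n, hn⟩ := exists_le_nsmul_of_relIndex_ne_zero hrank hE
    (sub_mem hpΩ (hgΩ 0)) (sub_mem hpΩ' hpΩ) (sub_pos.2 hlt)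
  obtain ⟨y, hy⟩ := hiter n
  have h1 := hs y
  rw [hg, ← hp, WithTop.coe_lt_coe] at h1
  rw [sub_le_iff_le_add'] at hn
  exact h1.not_ge (hn.trans hy)

/-- Telescoping and invariance of `v` show that in a cyclic group the minimal distance is attained
at the generator. -/
theorem map_sub_le_map_sub_pow (hens : IsHenselian (restr v K)) (σ : Ω ≃ₐ[K] Ω) (n : ℕ) :
    v ((α : C) - σ α) ≤ v ((α : C) - (σ ^ n) α) := by
  induction n with
  | zero => simp
  | succ n ih =>
    have e : (α : C) - ((σ ^ (n + 1)) α : Ω) =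
        ((α : C) - (σ α : Ω)) + ((σ (α - (σ ^ n) α) : Ω) : C) := by
      rw [pow_succ', AlgEquiv.mul_apply, map_sub, AddSubgroupClass.coe_sub,
        sub_add_sub_cancel]
    rw [e]
    refine v.map_le_add le_rfl ?_
    rw [map_algEquiv hens]
    exact ih

/-- The ramification ideals correspond to the distances of `α` from its conjugates. -/
theorem ramSet_eq_image_distIdeal [Normal K Ω] (hens : IsHenselian (restr v K))
    (hgen : K⟮(α : C)⟯ = Ω)
    (happ : ∀ z : C, deg K z < deg K (α : C) →
      ∃ y : K, v ((α : C) - z) ≤ v ((α : C) - algebraMap K C y))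
    (hlt : ∀ b : K, ∃ y : K,
      v ((α : C) - algebraMap K C b) < v ((α : C) - algebraMap K C y)) :
    ramSet v Ω = distIdeal K v Ω α '' conjDist K v (α : C) := by
  have hα : ∀ y : K, (α : C) - algebraMap K C y ≠ 0 := fun y h => by
    obtain ⟨y', hy'⟩ := hlt y
    rw [h, v.map_zero] at hy'
    exact not_top_lt hy'
  ext I
  constructor
  · rintro ⟨hbot, -, H, rfl⟩
    -- The identity is left out so that the minimum is a distance to a genuine conjugate; its own
    -- value is `⊤` and does not affect the minimum.
    obtain ⟨σ, ⟨hσ, hσ1⟩, hmin⟩ := Set.exists_min_image {σ : Ω ≃ₐ[K] Ω | σ ∈ H ∧ σ ≠ 1}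
      (fun σ => v ((α : C) - σ α)) (Set.toFinite _) (exists_ne_one_of_bot_lt_ramIdeal hbot)
    refine ⟨v ((α : C) - σ α), mem_conjDist_iff.2 ⟨σ, algEquiv_apply_ne hgen hσ1, rfl⟩,
      (ramIdeal_eq_distIdeal hens hgen happ hα hσ fun τ hτ => ?_).symm⟩
    by_cases hτ1 : τ = 1
    · simp [hτ1]
    · exact hmin τ ⟨hτ, hτ1⟩
  · rintro ⟨s, hs, rfl⟩
    obtain ⟨σ, hσ, rfl⟩ := mem_conjDist_iff.1 hs
    refine ⟨bot_lt_distIdeal hens hα hσ, distIdeal_le_maximalIdeal fun b => ?_,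
      Subgroup.zpowers σ, (ramIdeal_eq_distIdeal hens hgen happ hα
        (Subgroup.mem_zpowers σ) fun τ hτ => ?_).symm⟩
    · obtain ⟨y, hy⟩ := hlt b
      exact hy.trans_le (map_sub_algebraMap_le hens σ y)
    -- The Galois group is finite, so natural powers of `σ` suffice.
    · obtain ⟨n, rfl⟩ := mem_powers_iff_mem_zpowers.2 hτ
      exact map_sub_le_map_sub_pow hens σ n

theorem injOn_distIdeal [Normal K Ω] (hens : IsHenselian (restr v K))
    (hrank : rank (restr v K) = 1)
    (hE : (valueGroup (restr v K)).relIndex (valueGroup (restr v Ω)) ≠ 0)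
    (hlt : ∀ b : K, ∃ y : K,
      v ((α : C) - algebraMap K C b) < v ((α : C) - algebraMap K C y)) :
    Set.InjOn (distIdeal K v Ω α) (conjDist K v (α : C)) := by
  intro s hs s' hs' h
  obtain ⟨σ, hσ, rfl⟩ := mem_conjDist_iff.1 hs
  obtain ⟨τ, hτ, rfl⟩ := mem_conjDist_iff.1 hs'
  have hdist : ∀ (σ : Ω ≃ₐ[K] Ω) (b : K),
      v ((α : C) - algebraMap K C b) < v ((α : C) - σ α) := fun σ b => by
    obtain ⟨y, hy⟩ := hlt b
    exact hy.trans_le (map_sub_algebraMap_le hens σ y)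
  by_contra hne
  rcases lt_or_gt_of_ne hne with h' | h'
  · exact not_distIdeal_le_distIdeal hens hrank hE hτ h' (hdist σ) h.le
  · exact not_distIdeal_le_distIdeal hens hrank hE hσ h' (hdist τ) h.ge

end Ramification

end RamIdeals

end

theorem theorem8p17 {K C Γ : Type*} [Field K] [Field C] [Algebra K C] [IsAlgClosure K C]
    [AddCommGroup Γ] [LinearOrder Γ] [IsOrderedAddMonoid Γ]
    (v : AddValuation C (WithTop Γ))
    (hens : RamIdeals.IsHenselian (RamIdeals.restr v K))
    (hrank : RamIdeals.rank (RamIdeals.restr v K) = 1)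
    (Ω : IntermediateField K C) [FiniteDimensional K Ω] [IsGalois K Ω]
    (hdefect : 1 < RamIdeals.defect K v Ω)
    (hdepth : RamIdeals.extDepth K v Ω = 1)
    (a : C) (hgen : K⟮a⟯ = Ω) (hpure : RamIdeals.IsPure K v a) :
    (RamIdeals.ramSet v Ω).encard = (RamIdeals.conjDist K v a).encard := by
  have : IsAlgClosed C := IsAlgClosure.isAlgClosed K
  have haΩ : a ∈ Ω := hgen ▸ IntermediateField.mem_adjoin_simple_self K a
  have hE : (RamIdeals.valueGroup (RamIdeals.restr v K)).relIndex
      (RamIdeals.valueGroup (RamIdeals.restr v Ω)) ≠ 0 := fun h => by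
    rw [RamIdeals.defect, h] at hdefect
    norm_num at hdefect
  have hlt := hpure.exists_lt hdefect hgen
  rw [RamIdeals.ramSet_eq_image_distIdeal (α := ⟨a, haΩ⟩) hens hgen
    (fun z hz => hpure.exists_le hz) hlt]
  exact (RamIdeals.injOn_distIdeal (α := ⟨a, haΩ⟩) hens hrank hE hlt).encard_image
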